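/- **Theorem.** Let $\mathcal F=\bigoplus_{n\ge 0}L^2(\mathbb R_+^n;\mathbb C)$ be the full Fock space over $L^2(\mathbb R_+;\mathbb C)$, with vacuum vector $\Omega$. For $h\in L^2(\mathbb R_+;\mathbb R)$ let $S(h)=l(h)+l(h)^*$, where $l(h)\xi=h\otimes\xi$ is the left creation operator (so that $S_t=S(\mathbf 1_{[0,t]})$, $t\ge 0$, is a free Brownian motion). Let $\mathcal{SC}=\{S(h):h\in L^2(\mathbb R_+;\mathbb R)\}''\subset B(\mathcal F)$ be the von Neumann algebra of the free Brownian motion, with the trace $\tau(X)=\langle X\Omega,\Omega\rangle$, and identify $L^2(\mathcal{SC},\tau)$ with $\mathcal F$ through $X\mapsto X\Omega$. Let $\mathcal{SC}_{alg}$ be the unital $*$-algebra generated by the $S(h)$. The free Malliavin derivative $$\nabla:\mathcal{SC}_{alg}\to L^2\big(\mathbb R_+;L^2(\mathcal{SC})\otimes L^2(\mathcal{SC})\big)$$ is the linear map with $\nabla S(h)=h\cdot(1\otimes 1)$ and $\nabla(AB)=A\cdot\nabla B+\nabla A\cdot B$, where $A\cdot(X\otimes Y)\cdot B=AX\otimes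 YB$. Let $\mathbb D^{1,2}\subset L^2(\mathcal{SC},\tau)$ be the domain of its closure, that is, the completion of $\mathcal{SC}_{alg}$ for the norm $\big(\|Y\|_2^2+\|\nabla Y\|^2\big)^{1/2}$. Then the only central elements of $\mathcal{SC}$ that lie in $\mathbb D^{1,2}$ are the scalars: for a bounded operator $F$ on $\mathcal F$, one has $F\in\mathcal{SC}$, $F\in\mathbb D^{1,2}$ and $FG=GF$ for all $G\in\mathcal{SC}$ if and only if $F=c\,1$ for some $c\in\mathbb C$. -/

import Mathlib

open MeasureTheory
open scoped TensorProduct ENNReal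

noncomputable section

namespace Wigner

/-! ### The Hilbert spaces `L²(ℝ₊ⁿ)` and the full Fock space -/

/-- Lebesgue measure on `ℝ₊ = [0, ∞)`. -/
abbrev leb : Measure ℝ := volume.restrict (Set.Ici 0)

/-- The real Hilbert space `L²(ℝ₊; ℝ)`. -/
abbrev HR : Type := Lp ℝ 2 leb

/-- Its complexification `L²(ℝ₊; ℂ)`. -/
abbrev HC : Type := Lp ℂ 2 leb

/-- Lebesgue measure on `ℝ₊ⁿ`. -/
abbrev lebPow (n : ℕ) : Measure (Fin n → ℝ) := Measure.pi fun _ => leb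

/-- The `n`-th Hilbert space tensor power of `L²(ℝ₊; ℂ)`, realised as `L²(ℝ₊ⁿ; ℂ)`. -/
abbrev Chaos (n : ℕ) : Type := Lp ℂ 2 (lebPow n)

/-- The full Fock space: the Hilbert space direct sum of the `L²(ℝ₊ⁿ; ℂ)`, `n ≥ 0`
(the summand `n = 0` is one-dimensional, `ℝ₊⁰` being a point of mass one). -/
abbrev Fock : Type := lp Chaos 2

/-- The vacuum vector `Ω`: the constant function `1` in degree `0`. -/
def vacuum : Fock := lp.single 2 0 ((memLp_const (1 : ℂ)).toLp (fun _ : Fin 0 → ℝ => (1 : ℂ)))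

/-! ### Creation, annihilation and semicircular operators -/

theorem memLp_tensor {n : ℕ} (h : HC) (f : Chaos n) :
    MemLp (fun t : Fin (n + 1) → ℝ => h (t 0) * f (fun i => t i.succ)) 2 (lebPow (n + 1)) := by
  have h1 : MemLp (fun z : ℝ × (Fin n → ℝ) => h z.1 * f z.2) 2 (leb.prod (lebPow n)) := by
    rw [memLp_two_iff_integrable_sq_norm]
    · have := ((memLp_two_iff_integrable_sq_norm (Lp.aestronglyMeasurable h)).1
        (Lp.memLp h)).mul_prod
        ((memLp_two_iff_integrable_sq_norm (Lp.aestronglyMeasurable f)).1 (Lp.memLp f))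
      simpa [mul_pow] using this
    · exact (Lp.aestronglyMeasurable h).comp_fst.mul (Lp.aestronglyMeasurable f).comp_snd
  have h2 := measurePreserving_piFinSuccAbove (fun _ : Fin (n + 1) => leb) 0
  exact h1.comp_measurePreserving h2

/-- `h ⊗ f`, i.e. `(t₀, …, tₙ) ↦ h(t₀) f(t₁, …, tₙ)`. -/
def tensor {n : ℕ} (h : HC) (f : Chaos n) : Chaos (n + 1) := (memLp_tensor h f).toLp _

theorem tail_quasi (n : ℕ) :
    Measure.QuasiMeasurePreserving (fun t : Fin (n + 1) → ℝ => fun i : Fin n => t i.succ)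
      (lebPow (n + 1)) (lebPow n) :=
  Measure.quasiMeasurePreserving_snd.comp
    (measurePreserving_piFinSuccAbove (fun _ : Fin (n + 1) => leb) 0).quasiMeasurePreserving

theorem tensor_add {n : ℕ} (h : HC) (f g : Chaos n) :
    tensor h (f + g) = tensor h f + tensor h g := by
  rw [tensor, tensor, tensor, ← MemLp.toLp_add, MemLp.toLp_eq_toLp_iff]
  filter_upwards [(tail_quasi n).ae (Lp.coeFn_add f g)] with t ht
  rw [Pi.add_apply] at ht
  rw [Pi.add_apply, ← mul_add]
  exact congrArg _ ht

theorem tensor_smul {n : ℕ} (h : HC) (c : ℂ) (f : Chaos n) :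
    tensor h (c • f) = c • tensor h f := by
  rw [tensor, tensor, ← MemLp.toLp_const_smul, MemLp.toLp_eq_toLp_iff]
  filter_upwards [(tail_quasi n).ae (Lp.coeFn_smul c f)] with t ht
  simp [ht, mul_left_comm]

theorem norm_sq_eq_integral {α : Type} [MeasurableSpace α] {μ : Measure α} (f : Lp ℂ 2 μ) :
    ‖f‖ ^ 2 = ∫ x, ‖f x‖ ^ 2 ∂μ := by
  have h := L2.inner_def (𝕜 := ℂ) f f
  rw [inner_self_eq_norm_sq_to_K] at h
  have h2 : ∀ x, inner ℂ (f x) (f x) = (((‖f x‖ ^ 2 : ℝ)) : ℂ) := fun x => by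
    rw [inner_self_eq_norm_sq_to_K]; norm_cast
  simp_rw [h2] at h
  have h3 := (integral_ofReal (𝕜 := ℂ) (f := fun x => ‖f x‖ ^ 2) (μ := μ))
  exact_mod_cast h.trans h3

theorem norm_tensor_sq {n : ℕ} (h : HC) (f : Chaos n) :
    ‖tensor h f‖ ^ 2 = ‖h‖ ^ 2 * ‖f‖ ^ 2 := by
  have h2 := measurePreserving_piFinSuccAbove (fun _ : Fin (n + 1) => leb) 0
  rw [norm_sq_eq_integral, norm_sq_eq_integral, norm_sq_eq_integral,
    ← integral_prod_mul,
    ← h2.integral_comp (MeasurableEquiv.piFinSuccAbove _ 0).measurableEmbedding]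
  refine integral_congr_ae ?_
  filter_upwards [MemLp.coeFn_toLp (memLp_tensor h f)] with t ht
  rw [tensor, ht, norm_mul, mul_pow]
  rfl

/-- The components of `h ⊗ ξ`: zero in degree `0` and `h ⊗ ξₙ` in degree `n + 1`. -/
def createFun (h : HC) (ξ : Fock) : (n : ℕ) → Chaos n
  | 0 => 0
  | n + 1 => tensor h (ξ n)

theorem hasSum_createFun (h : HC) (ξ : Fock) :
    HasSum (fun n => ‖createFun h ξ n‖ ^ (2 : ℝ≥0∞).toReal) ((‖h‖ * ‖ξ‖) ^ (2 : ℝ≥0∞).toReal) := by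
  have h0 : (0 : ℝ) < (2 : ℝ≥0∞).toReal := by norm_num
  have h1 := (lp.hasSum_norm h0 ξ).mul_left (‖h‖ ^ (2 : ℝ≥0∞).toReal)
  rw [← hasSum_nat_add_iff' 1]
  simpa [createFun, norm_tensor_sq, mul_pow] using h1

/-- The left creation operator `l(h) : ξ ↦ h ⊗ ξ`. -/
def leftCreation (h : HC) : Fock →L[ℂ] Fock :=
  LinearMap.mkContinuous
    { toFun := fun ξ => ⟨createFun h ξ, memℓp_gen (hasSum_createFun h ξ).summable⟩
      map_add' := fun ξ η => by
        ext1; funext n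
        cases n with
        | zero => exact (add_zero (0 : Chaos 0)).symm
        | succ n => exact tensor_add h (ξ n) (η n)
      map_smul' := fun c ξ => by
        ext1; funext n
        cases n with
        | zero => simp [createFun]
        | succ n => simp [createFun, tensor_smul] }
    ‖h‖ (fun ξ => by
      refine lp.norm_le_of_tsum_le (by norm_num) (by positivity) ?_
      exact (hasSum_createFun h ξ).tsum_eq.le)

/-- The complexification `L²(ℝ₊; ℝ) → L²(ℝ₊; ℂ)`. -/
def complexify (h : HR) : HC := Complex.ofRealCLM.compLp h

/-- The semicircular operator `S(h) = l(h) + l(h)*`, for real `h`; the free Brownian motion is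
`S_t = S(1_{[0,t]})`. -/
def S (h : HR) : Fock →L[ℂ] Fock :=
  leftCreation (complexify h) + ContinuousLinearMap.adjoint (leftCreation (complexify h))

theorem star_S (h : HR) : star (S h) = S h := by
  simp [S, ContinuousLinearMap.star_eq_adjoint, add_comm]

/-- The von Neumann algebra `{S(h) : h ∈ L²(ℝ₊; ℝ)}''` of the free Brownian motion. -/
def SC : VonNeumannAlgebra Fock where
  toStarSubalgebra := StarSubalgebra.centralizer ℂ (Set.centralizer (Set.range S))
  centralizer_centralizer' := by
    change Set.centralizer (Set.centralizer
      (StarSubalgebra.centralizer ℂ (Set.centralizer (Set.range S)) : Set (Fock →L[ℂ] Fock))) =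
      (StarSubalgebra.centralizer ℂ (Set.centralizer (Set.range S)) : Set (Fock →L[ℂ] Fock))
    simp

theorem coe_SC : (SC : Set (Fock →L[ℂ] Fock)) = Set.centralizer (Set.centralizer (Set.range S)) := by
  change (StarSubalgebra.centralizer ℂ (Set.centralizer (Set.range S)) :
    Set (Fock →L[ℂ] Fock)) = _
  have h : star (Set.range S) = Set.range S := by
    ext A
    constructor
    · rintro ⟨h, hh⟩
      exact ⟨h, by rw [← star_S, hh, star_star]⟩
    · rintro ⟨h, rfl⟩
      exact ⟨h, (star_S h).symm⟩
  rw [StarSubalgebra.coe_centralizer, Set.star_centralizer, h, Set.union_self]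

/-! ### The free Malliavin derivative -/

/-- Bounded operators on the Fock space. -/
abbrev Op : Type := Fock →L[ℂ] Fock

/-- Algebraic biprocesses: finite sums of `h ⊗ (X ⊗ Y)`, which stands for `t ↦ h(t) X ⊗ Y`. -/
abbrev AlgBiprocess : Type := HC ⊗[ℂ] (Op ⊗[ℂ] Op)

/-- The left action, multiplication on the left leg: `A · (h ⊗ (X ⊗ Y)) = h ⊗ (A X ⊗ Y)`. -/
def leftAct (A : Op) : AlgBiprocess →ₗ[ℂ] AlgBiprocess :=
  (TensorProduct.map (LinearMap.mulLeft ℂ A) LinearMap.id).lTensor HC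

/-- The right action, opposite multiplication on the right leg:
`(h ⊗ (X ⊗ Y)) · B = h ⊗ (X ⊗ Y B)`. -/
def rightAct (B : Op) : AlgBiprocess →ₗ[ℂ] AlgBiprocess :=
  (TensorProduct.map LinearMap.id (LinearMap.mulRight ℂ B)).lTensor HC

/-- `IsGradient A u` says that `A` lies in the unital `*`-algebra generated by the (self-adjoint)
`S(h)` and `∇A = u`, where `∇` is the derivation on that algebra with `∇S(h) = h ⊗ (1 ⊗ 1)`. -/
inductive IsGradient : Op → AlgBiprocess → Prop
  | one : IsGradient 1 0
  | S (h : HR) : IsGradient (S h) (complexify h ⊗ₜ[ℂ] ((1 : Op) ⊗ₜ[ℂ] (1 : Op)))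
  | add {A B : Op} {u v : AlgBiprocess} :
      IsGradient A u → IsGradient B v → IsGradient (A + B) (u + v)
  | smul (c : ℂ) {A : Op} {u : AlgBiprocess} : IsGradient A u → IsGradient (c • A) (c • u)
  | mul {A B : Op} {u v : AlgBiprocess} :
      IsGradient A u → IsGradient B v → IsGradient (A * B) (leftAct A v + rightAct B u)

/-- The identification `X ↦ X Ω` of (a dense subspace of) `L²(SC, τ)` with the Fock space, where
`τ(X) = ⟨X Ω, Ω⟩`. -/
def toL2 : Op →ₗ[ℂ] Fock := (ContinuousLinearMap.apply ℂ Fock vacuum).toLinearMap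

/-- The Hilbert space tensor product `L²(SC) ⊗ L²(SC)`. -/
abbrev FockTwo : Type := UniformSpace.Completion (Fock ⊗[ℂ] Fock)

/-- The square integrable biprocesses `L²(ℝ₊; L²(SC) ⊗ L²(SC))`. -/
abbrev Biprocess : Type := Lp FockTwo 2 leb

/-- The linear map `X ⊗ Y ↦ XΩ ⊗ YΩ`. -/
def toFockTwo : Op ⊗[ℂ] Op →ₗ[ℂ] FockTwo :=
  (UniformSpace.Completion.toComplL (𝕜 := ℂ) (E := Fock ⊗[ℂ] Fock)).toLinearMap ∘ₗ
    TensorProduct.map toL2 toL2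

/-- The linear map sending `h ⊗ (X ⊗ Y)` to the biprocess `t ↦ h(t) (XΩ ⊗ YΩ)`. -/
def toBiprocess : AlgBiprocess →ₗ[ℂ] Biprocess :=
  TensorProduct.lift <| LinearMap.mk₂ ℂ
    (fun (h : HC) (w : Op ⊗[ℂ] Op) =>
      (ContinuousLinearMap.toSpanSingleton ℂ (toFockTwo w)).compLp h)
    (fun h k w => (ContinuousLinearMap.compLpₗ 2 leb _).map_add h k)
    (fun c h w => (ContinuousLinearMap.compLpₗ 2 leb _).map_smul c h)
    (fun h w z => by
      rw [map_add, ContinuousLinearMap.toSpanSingleton_add, ContinuousLinearMap.add_compLp])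
    (fun c h w => by
      rw [map_smul, ContinuousLinearMap.toSpanSingleton_smul, ContinuousLinearMap.smul_compLp])

/-- The graph of `∇`, as a subspace of `L²(SC) × L²(ℝ₊; L²(SC) ⊗ L²(SC))`. -/
def gradientGraph : Submodule ℂ (Fock × Biprocess) where
  carrier := {p | ∃ A u, IsGradient A u ∧ p = (toL2 A, toBiprocess u)}
  zero_mem' := ⟨(0 : ℂ) • 1, (0 : ℂ) • 0, IsGradient.one.smul 0, by ext1 <;> simp⟩
  add_mem' := by
    rintro _ _ ⟨A, u, hA, rfl⟩ ⟨B, v, hB, rfl⟩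
    exact ⟨A + B, u + v, hA.add hB, by ext1 <;> simp⟩
  smul_mem' := by
    rintro c _ ⟨A, u, hA, rfl⟩
    exact ⟨c • A, c • u, hA.smul c, by ext1 <;> simp⟩

/-- The Sobolev space `𝔻^{1,2} ⊆ L²(SC)`: the domain of the closure of `∇`, i.e. the completion of
its initial domain for the norm `‖Y‖² = ‖Y‖₂² + ‖∇Y‖²`. -/
def D12 : Submodule ℂ Fock :=
  gradientGraph.topologicalClosure.map (LinearMap.fst ℂ Fock Biprocess)

end Wigner

end

/-! Write `l`, `r` for left and right creation and `P` for the projection onto the vacuum line. The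
centre is trivial because left and right semicircular operators coincide on the vector `ξ = FΩ`, and
this forces `ξ` to be a multiple of `Ω`.

The operators `rightS h = r(h) + r(h)*` commute with every `S k` (`S_mul_rightS`), hence with `F`.
Since `S h Ω = rightS h Ω`, a central `F` gives `S h ξ = F (S h Ω) = F (rightS h Ω) = rightS h ξ`.

For a real unit vector `e`, applying `l(e)*` to `l(e)ξ + l(e)*ξ = r(e)ξ + r(e)*ξ` and using
`l(e)*l(e) = 1` and `l(e)*r(e) = r(e)l(e)* + P` yields `ξ - Pξ = r(e)l(e)*ξ + l(e)*r(e)*ξ -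
l(e)*l(e)*ξ`. Along an orthonormal sequence, `l(e)*ξ` and `r(e)*ξ` tend to zero, so `ξ = Pξ`
(`eq_vacuumProj_of_S_eq_rightS`). Thus `FΩ = cΩ`, and cyclicity of `Ω` for the `S h` gives `F = c`
(`eq_smul_one_of_commute`). -/

noncomputable section

/-! ### Density of elementary tensors, and orthonormal sequences -/

/-- A function on a product space whose integrals over rectangles of finite measure vanish is
almost everywhere zero. -/
theorem ae_eq_zero_of_forall_setIntegral_prod {X Y : Type*} [MeasurableSpace X]
    [MeasurableSpace Y] {μ : Measure X} {ν : Measure Y} [SigmaFinite μ] [SigmaFinite ν]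
    {f : X × Y → ℂ}
    (hf : ∀ s t, MeasurableSet s → MeasurableSet t → μ s ≠ ∞ → ν t ≠ ∞ →
      IntegrableOn f (s ×ˢ t) (μ.prod ν))
    (h0 : ∀ s t, MeasurableSet s → MeasurableSet t → μ s ≠ ∞ → ν t ≠ ∞ →
      ∫ z in s ×ˢ t, f z ∂(μ.prod ν) = 0) :
    f =ᵐ[μ.prod ν] 0 := by
  have key : ∀ s t, MeasurableSet s → MeasurableSet t → μ s ≠ ∞ → ν t ≠ ∞ →
      f =ᵐ[(μ.prod ν).restrict (s ×ˢ t)] 0 := by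
    intro s t hs ht hμs hνt
    have hint : Integrable f ((μ.prod ν).restrict (s ×ˢ t)) := hf s t hs ht hμs hνt
    -- The complex measure with density `f` on a finite rectangle vanishes on the π-system of all
    -- rectangles, hence everywhere.
    refine hint.ae_eq_of_withDensityᵥ_eq (integrable_zero _ _ _) ?_
    refine VectorMeasure.ext_of_generateFrom _ ?_ generateFrom_prod.symm isPiSystem_prod ?_
    · rintro _ ⟨a, ha, b, hb, rfl⟩
      have ha : MeasurableSet a := ha
      have hb : MeasurableSet b := hb
      rw [withDensityᵥ_apply hint (ha.prod hb), Measure.restrict_restrict (ha.prod hb),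
        Set.prod_inter_prod, h0 _ _ (ha.inter hs) (hb.inter ht)
          (measure_ne_top_of_subset Set.inter_subset_right hμs)
          (measure_ne_top_of_subset Set.inter_subset_right hνt)]
      simp
    · rw [withDensityᵥ_apply hint MeasurableSet.univ, Measure.restrict_univ,
        h0 s t hs ht hμs hνt]
      simp
  have hcover : (⋃ p : ℕ × ℕ, spanningSets μ p.1 ×ˢ spanningSets ν p.2) = Set.univ := by
    rw [Set.iUnion_prod (fun i => spanningSets μ i) (fun i => spanningSets ν i),
      iUnion_spanningSets, iUnion_spanningSets, Set.univ_prod_univ]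
  rw [Filter.EventuallyEq, ← Measure.restrict_univ (μ := μ.prod ν), ← hcover, ae_restrict_iUnion_iff]
  exact fun p => key _ _ (measurableSet_spanningSets μ _) (measurableSet_spanningSets ν _)
    (measure_spanningSets_lt_top μ _).ne (measure_spanningSets_lt_top ν _).ne

namespace Wigner

theorem coeFn_tensor {n : ℕ} (h : HC) (f : Chaos n) :
    tensor h f =ᵐ[lebPow (n + 1)] fun t => h (t 0) * f (fun i => t i.succ) :=
  MemLp.coeFn_toLp (memLp_tensor h f)

theorem inner_tensor_tensor {n : ℕ} (h k : HC) (f g : Chaos n) :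
    inner ℂ (tensor h f) (tensor k g) = inner ℂ h k * inner ℂ f g := by
  have h2 := measurePreserving_piFinSuccAbove (fun _ : Fin (n + 1) => leb) 0
  rw [L2.inner_def, L2.inner_def, L2.inner_def, ← integral_prod_mul,
    ← h2.integral_comp (MeasurableEquiv.piFinSuccAbove _ 0).measurableEmbedding]
  refine integral_congr_ae ?_
  filter_upwards [coeFn_tensor h f, coeFn_tensor k g] with t ht ht'
  rw [ht, ht']
  change inner ℂ (h (t 0) * f (fun i => t i.succ)) (k (t 0) * g (fun i => t i.succ)) =
    inner ℂ (h (t 0)) (k (t 0)) * inner ℂ (f (fun i => t i.succ)) (g (fun i => t i.succ))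
  simp only [RCLike.inner_apply, map_mul]
  ring

theorem coeFn_complexify (h : HR) : complexify h =ᵐ[leb] fun t => (h t : ℂ) :=
  Complex.ofRealCLM.coeFn_compLp h

/-- The elementary tensors with a real first factor. -/
def realTensors (n : ℕ) : Set (Chaos (n + 1)) :=
  {x | ∃ (h : HR) (f : Chaos n), x = tensor (complexify h) f}

theorem head_quasi (n : ℕ) :
    Measure.QuasiMeasurePreserving (fun t : Fin (n + 1) → ℝ => t 0) (lebPow (n + 1)) leb :=
  Measure.quasiMeasurePreserving_fst.comp
    (measurePreserving_piFinSuccAbove (fun _ : Fin (n + 1) => leb) 0).quasiMeasurePreserving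

/-- Links orthogonality to elementary tensors with vanishing of integrals over rectangles. -/
theorem inner_tensor_indicator {n : ℕ} {s : Set ℝ} {t : Set (Fin n → ℝ)} (hs : MeasurableSet s)
    (ht : MeasurableSet t) (hμs : leb s ≠ ∞) (hμt : lebPow n t ≠ ∞) (f : Chaos (n + 1)) :
    inner ℂ (tensor (complexify (indicatorConstLp 2 hs hμs (1 : ℝ)))
        (indicatorConstLp 2 ht hμt (1 : ℂ))) f =
      ∫ z in s ×ˢ t, f ((MeasurableEquiv.piFinSuccAbove (fun _ : Fin (n + 1) => ℝ) 0).symm z)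
        ∂(leb.prod (lebPow n)) := by
  have h2 := measurePreserving_piFinSuccAbove (fun _ : Fin (n + 1) => leb) 0
  rw [L2.inner_def, ← integral_indicator (hs.prod ht),
    ← h2.integral_comp (MeasurableEquiv.piFinSuccAbove _ 0).measurableEmbedding]
  refine integral_congr_ae ?_
  filter_upwards [coeFn_tensor (complexify (indicatorConstLp 2 hs hμs (1 : ℝ)))
      (indicatorConstLp 2 ht hμt (1 : ℂ)),
    (head_quasi n).ae (coeFn_complexify (indicatorConstLp 2 hs hμs (1 : ℝ))),
    (head_quasi n).ae (indicatorConstLp_coeFn (p := 2) (hs := hs) (hμs := hμs) (c := (1 : ℝ))),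
    (tail_quasi n).ae (indicatorConstLp_coeFn (p := 2) (hs := ht) (hμs := hμt) (c := (1 : ℂ)))]
    with x h1 h2 h3 h4
  classical
  have hR : (s ×ˢ t).indicator (fun z => f ((MeasurableEquiv.piFinSuccAbove
      (fun _ : Fin (n + 1) => ℝ) 0).symm z))
      ((MeasurableEquiv.piFinSuccAbove (fun _ : Fin (n + 1) => ℝ) 0) x) =
      if x 0 ∈ s ∧ (fun i : Fin n => x i.succ) ∈ t then f x else 0 := by
    rw [Set.indicator_apply, MeasurableEquiv.symm_apply_apply]
    exact if_congr Iff.rfl rfl rfl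
  rw [hR, h1, h2, h3, h4]
  by_cases ha : x 0 ∈ s <;> by_cases hb : (fun i : Fin n => x i.succ) ∈ t <;>
    simp [Set.indicator, ha, hb]

/-- A vector orthogonal to these tensors has zero integral over every rectangle of finite measure,
so it vanishes. Indicators are real, so real first factors suffice. -/
theorem topologicalClosure_span_realTensors (n : ℕ) :
    (Submodule.span ℂ (realTensors n)).topologicalClosure = ⊤ := by
  rw [Submodule.topologicalClosure_eq_top_iff, Submodule.eq_bot_iff]
  intro f hf
  have hf' : ∀ x ∈ realTensors n, inner ℂ x f = 0 := fun x hx =>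
    (Submodule.mem_orthogonal _ f).1 hf x (Submodule.subset_span hx)
  have h2 := measurePreserving_piFinSuccAbove (fun _ : Fin (n + 1) => leb) 0
  set e := MeasurableEquiv.piFinSuccAbove (fun _ : Fin (n + 1) => ℝ) 0 with he
  have hL : MemLp (fun z => f (e.symm z)) 2 (leb.prod (lebPow n)) :=
    (Lp.memLp f).comp_measurePreserving h2.symm
  have hz : (fun z => f (e.symm z)) =ᵐ[leb.prod (lebPow n)] 0 := by
    refine ae_eq_zero_of_forall_setIntegral_prod ?_ ?_
    · intro s t hs ht hμs hμt
      have hfin : leb.prod (lebPow n) (s ×ˢ t) ≠ ∞ := by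
        rw [Measure.prod_prod]; exact ENNReal.mul_ne_top hμs hμt
      have : IsFiniteMeasure ((leb.prod (lebPow n)).restrict (s ×ˢ t)) :=
        ⟨by rw [Measure.restrict_apply_univ]; exact hfin.lt_top⟩
      exact (hL.restrict _).integrable one_le_two
    · intro s t hs ht hμs hμt
      rw [← inner_tensor_indicator hs ht hμs hμt f]
      exact hf' _ ⟨_, _, rfl⟩
  rw [Lp.eq_zero_iff_ae_eq_zero]
  filter_upwards [h2.quasiMeasurePreserving.ae hz] with x hx
  have : f (e.symm (e x)) = 0 := hx
  simpa using this

/-- Infinite dimensionality is what the limiting argument for `ξ = Pξ` rests on. The witnesses are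
the indicators of the disjoint unit intervals `[k, k + 1)`. -/
theorem exists_orthonormal_HR : ∃ h : ℕ → HR, Orthonormal ℝ h := by
  have hs : ∀ k : ℕ, MeasurableSet (Set.Ico (k : ℝ) (k + 1)) := fun k => measurableSet_Ico
  have hsub : ∀ k : ℕ, Set.Ico (k : ℝ) (k + 1) ⊆ Set.Ici 0 := fun k x hx =>
    (Nat.cast_nonneg k).trans hx.1
  have hv : ∀ k : ℕ, leb (Set.Ico (k : ℝ) (k + 1)) = 1 := fun k => by
    rw [Measure.restrict_apply (hs k), Set.inter_eq_left.2 (hsub k)]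
    simp
  have hv' : ∀ k : ℕ, leb (Set.Ico (k : ℝ) (k + 1)) ≠ ∞ := fun k => by simp [hv k]
  refine ⟨fun k => indicatorConstLp 2 (hs k) (hv' k) (1 : ℝ), ?_⟩
  rw [orthonormal_iff_ite]
  intro i j
  rw [L2.real_inner_indicatorConstLp_one_indicatorConstLp_one (hs i) (hs j) (hv' i) (hv' j)]
  split_ifs with hij
  · subst hij
    rw [Set.inter_self, Measure.real, hv i, ENNReal.toReal_one]
  · have : Set.Ico (i : ℝ) (i + 1) ∩ Set.Ico (j : ℝ) (j + 1) = ∅ := by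
      ext x
      simp only [Set.mem_inter_iff, Set.mem_Ico, Set.mem_empty_iff_false, iff_false]
      rintro ⟨⟨h1, h2⟩, h3, h4⟩
      apply hij
      have h5 : (i : ℝ) < j + 1 := by linarith
      have h6 : (j : ℝ) < i + 1 := by linarith
      norm_cast at h5 h6
      omega
    rw [this]; simp

theorem inner_complexify (h k : HR) :
    inner ℂ (complexify h) (complexify k) = ((inner ℝ h k : ℝ) : ℂ) := by
  rw [L2.inner_def, L2.inner_def]
  refine Eq.trans ?_ integral_ofReal
  refine integral_congr_ae ?_
  filter_upwards [coeFn_complexify h, coeFn_complexify k] with t h1 h2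
  rw [h1, h2]
  simp

/-! ### Right creation operators -/

theorem memLp_tensorRight {n : ℕ} (f : Chaos n) (h : HC) :
    MemLp (fun t : Fin (n + 1) → ℝ => f (fun i => t i.castSucc) * h (t (Fin.last n))) 2
      (lebPow (n + 1)) := by
  -- The coordinate split off by `piFinSuccAbove` always comes first in the product, even when it is
  -- the last one; hence `h` is evaluated at `z.1`.
  have h1 : MemLp (fun z : ℝ × (Fin n → ℝ) => f z.2 * h z.1) 2 (leb.prod (lebPow n)) := by
    rw [memLp_two_iff_integrable_sq_norm]
    · have := ((memLp_two_iff_integrable_sq_norm (Lp.aestronglyMeasurable h)).1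
        (Lp.memLp h)).mul_prod
        ((memLp_two_iff_integrable_sq_norm (Lp.aestronglyMeasurable f)).1 (Lp.memLp f))
      simpa [mul_pow, mul_comm] using this
    · exact (Lp.aestronglyMeasurable f).comp_snd.mul (Lp.aestronglyMeasurable h).comp_fst
  have h2 := measurePreserving_piFinSuccAbove (fun _ : Fin (n + 1) => leb) (Fin.last n)
  have h3 := h1.comp_measurePreserving h2
  refine (congrArg (fun F => MemLp F 2 (lebPow (n + 1))) (funext fun t => ?_)).mp h3
  simp only [MeasurableEquiv.piFinSuccAbove, MeasurableEquiv.coe_mk, Fin.insertNthEquiv_last]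
  rfl

/-- `f ⊗ h`, i.e. `(t₀, …, tₙ) ↦ f(t₀, …, tₙ₋₁) h(tₙ)`. -/
def tensorRight {n : ℕ} (f : Chaos n) (h : HC) : Chaos (n + 1) := (memLp_tensorRight f h).toLp _

theorem coeFn_tensorRight {n : ℕ} (f : Chaos n) (h : HC) :
    tensorRight f h =ᵐ[lebPow (n + 1)]
      fun t => f (fun i => t i.castSucc) * h (t (Fin.last n)) :=
  MemLp.coeFn_toLp (memLp_tensorRight f h)

theorem init_quasi (n : ℕ) :
    Measure.QuasiMeasurePreserving (fun t : Fin (n + 1) → ℝ => fun i : Fin n => t i.castSucc)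
      (lebPow (n + 1)) (lebPow n) := by
  have h := Measure.quasiMeasurePreserving_snd.comp
    (measurePreserving_piFinSuccAbove (fun _ : Fin (n + 1) => leb)
      (Fin.last n)).quasiMeasurePreserving
  refine (congrArg (fun F => Measure.QuasiMeasurePreserving F (lebPow (n + 1)) (lebPow n))
    (funext fun t => funext fun i => ?_)).mp h
  simp [MeasurableEquiv.piFinSuccAbove, Fin.init]

theorem tensorRight_add {n : ℕ} (f g : Chaos n) (h : HC) :
    tensorRight (f + g) h = tensorRight f h + tensorRight g h := by
  rw [tensorRight, tensorRight, tensorRight, ← MemLp.toLp_add, MemLp.toLp_eq_toLp_iff]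
  filter_upwards [(init_quasi n).ae (Lp.coeFn_add f g)] with t ht
  rw [Pi.add_apply] at ht
  rw [Pi.add_apply, ← add_mul]
  exact congrArg (· * _) ht

theorem tensorRight_smul {n : ℕ} (c : ℂ) (f : Chaos n) (h : HC) :
    tensorRight (c • f) h = c • tensorRight f h := by
  rw [tensorRight, tensorRight, ← MemLp.toLp_const_smul, MemLp.toLp_eq_toLp_iff]
  filter_upwards [(init_quasi n).ae (Lp.coeFn_smul c f)] with t ht
  simp [ht, mul_assoc]

theorem norm_tensorRight_sq {n : ℕ} (f : Chaos n) (h : HC) :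
    ‖tensorRight f h‖ ^ 2 = ‖h‖ ^ 2 * ‖f‖ ^ 2 := by
  have h2 := measurePreserving_piFinSuccAbove (fun _ : Fin (n + 1) => leb) (Fin.last n)
  rw [norm_sq_eq_integral, norm_sq_eq_integral, norm_sq_eq_integral,
    ← integral_prod_mul,
    ← h2.integral_comp (MeasurableEquiv.piFinSuccAbove _ (Fin.last n)).measurableEmbedding]
  refine integral_congr_ae ?_
  filter_upwards [coeFn_tensorRight f h] with t ht
  rw [ht, norm_mul, mul_pow, mul_comm]
  simp only [MeasurableEquiv.piFinSuccAbove, MeasurableEquiv.coe_mk, Fin.insertNthEquiv_last]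
  rfl

theorem tensor_tensorRight {n : ℕ} (h : HC) (f : Chaos n) (k : HC) :
    tensor h (tensorRight f k) = tensorRight (tensor h f) k := by
  apply Lp.ext
  filter_upwards [coeFn_tensor h (tensorRight f k), coeFn_tensorRight (tensor h f) k,
    (tail_quasi (n + 1)).ae (coeFn_tensorRight f k),
    (init_quasi (n + 1)).ae (coeFn_tensor h f)] with t h1 h2 h3 h4
  rw [h1, h2, h3, h4]
  simp [mul_assoc]

/-- The constant function `1` in degree `0`. -/
def unitChaos : Chaos 0 := (memLp_const (1 : ℂ)).toLp (fun _ : Fin 0 → ℝ => (1 : ℂ))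

theorem vacuum_eq_single : vacuum = lp.single 2 0 unitChaos := rfl

theorem coeFn_unitChaos : unitChaos =ᵐ[lebPow 0] fun _ => (1 : ℂ) :=
  MemLp.coeFn_toLp (memLp_const (1 : ℂ))

theorem tensor_unitChaos (h : HC) : tensor h unitChaos = tensorRight unitChaos h := by
  apply Lp.ext
  filter_upwards [coeFn_tensor h unitChaos, coeFn_tensorRight unitChaos h,
    (tail_quasi 0).ae coeFn_unitChaos, (init_quasi 0).ae coeFn_unitChaos] with t h1 h2 h3 h4
  rw [h1, h2, h3, h4]
  simp

/-- The components of `ξ ⊗ h`: zero in degree `0` and `ξₙ ⊗ h` in degree `n + 1`. -/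
def createRightFun (h : HC) (ξ : Fock) : (n : ℕ) → Chaos n
  | 0 => 0
  | n + 1 => tensorRight (ξ n) h

theorem hasSum_createRightFun (h : HC) (ξ : Fock) :
    HasSum (fun n => ‖createRightFun h ξ n‖ ^ (2 : ℝ≥0∞).toReal)
      ((‖h‖ * ‖ξ‖) ^ (2 : ℝ≥0∞).toReal) := by
  have h0 : (0 : ℝ) < (2 : ℝ≥0∞).toReal := by norm_num
  have h1 := (lp.hasSum_norm h0 ξ).mul_left (‖h‖ ^ (2 : ℝ≥0∞).toReal)
  rw [← hasSum_nat_add_iff' 1]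
  simpa [createRightFun, norm_tensorRight_sq, mul_pow] using h1

/-- The right creation operator `r(h) : ξ ↦ ξ ⊗ h`. -/
def rightCreation (h : HC) : Fock →L[ℂ] Fock :=
  LinearMap.mkContinuous
    { toFun := fun ξ => ⟨createRightFun h ξ, memℓp_gen (hasSum_createRightFun h ξ).summable⟩
      map_add' := fun ξ η => by
        ext1; funext n
        cases n with
        | zero => exact (add_zero (0 : Chaos 0)).symm
        | succ n => exact tensorRight_add (ξ n) (η n) h
      map_smul' := fun c ξ => by
        ext1; funext n
        cases n with
        | zero => simp [createRightFun]
        | succ n => simp [createRightFun, tensorRight_smul] }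
    ‖h‖ (fun ξ => by
      refine lp.norm_le_of_tsum_le (by norm_num) (by positivity) ?_
      exact (hasSum_createRightFun h ξ).tsum_eq.le)

end Wigner

end

noncomputable section

open Filter Topology

namespace Wigner

open ContinuousLinearMap (adjoint)

/-! ### Creation and annihilation on the Fock space, and cyclicity of the vacuum -/

theorem tensor_zero {n : ℕ} (h : HC) : tensor h (0 : Chaos n) = 0 := by
  simpa using tensor_smul h 0 (0 : Chaos n)

theorem tensorRight_zero {n : ℕ} (h : HC) : tensorRight (0 : Chaos n) h = 0 := by
  simpa using tensorRight_smul 0 (0 : Chaos n) h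

theorem leftCreation_apply_zero (h : HC) (ξ : Fock) : leftCreation h ξ 0 = 0 := rfl

theorem leftCreation_apply_succ (h : HC) (ξ : Fock) (n : ℕ) :
    leftCreation h ξ (n + 1) = tensor h (ξ n) := rfl

theorem rightCreation_apply_zero (h : HC) (ξ : Fock) : rightCreation h ξ 0 = 0 := rfl

theorem rightCreation_apply_succ (h : HC) (ξ : Fock) (n : ℕ) :
    rightCreation h ξ (n + 1) = tensorRight (ξ n) h := rfl

theorem norm_leftCreation_le (h : HC) : ‖leftCreation h‖ ≤ ‖h‖ :=
  LinearMap.mkContinuous_norm_le _ (norm_nonneg h) _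

theorem norm_rightCreation_le (h : HC) : ‖rightCreation h‖ ≤ ‖h‖ :=
  LinearMap.mkContinuous_norm_le _ (norm_nonneg h) _

theorem inner_leftCreation (h k : HC) (ξ η : Fock) :
    inner ℂ (leftCreation h ξ) (leftCreation k η) = inner ℂ h k * inner ℂ ξ η := by
  have h1 := lp.hasSum_inner (𝕜 := ℂ) (leftCreation h ξ) (leftCreation k η)
  rw [← hasSum_nat_add_iff' 1] at h1
  simp only [leftCreation_apply_succ, inner_tensor_tensor, Finset.range_one,
    Finset.sum_singleton, leftCreation_apply_zero, inner_zero_left, sub_zero] at h1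
  exact h1.unique ((lp.hasSum_inner (𝕜 := ℂ) ξ η).mul_left _)

theorem adjoint_leftCreation_leftCreation (h k : HC) (ξ : Fock) :
    adjoint (leftCreation h) (leftCreation k ξ) = inner ℂ h k • ξ :=
  ext_inner_left ℂ fun η => by
    rw [ContinuousLinearMap.adjoint_inner_right, inner_leftCreation, inner_smul_right]

theorem inner_vacuum_right (ξ : Fock) : inner ℂ ξ vacuum = inner ℂ (ξ 0) unitChaos := by
  rw [vacuum_eq_single, lp.inner_single_right]

theorem inner_vacuum_vacuum : inner ℂ vacuum vacuum = (1 : ℂ) := by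
  rw [inner_vacuum_right, vacuum_eq_single, lp.single_apply_self, L2.inner_def]
  have : (fun a => inner ℂ (unitChaos a) (unitChaos a)) =ᵐ[lebPow 0] fun _ => (1 : ℂ) := by
    filter_upwards [coeFn_unitChaos] with t ht
    simp [ht]
  rw [integral_congr_ae this]
  simp [lebPow, Measure.real]

theorem inner_vacuum_leftCreation (h : HC) (ξ : Fock) :
    inner ℂ vacuum (leftCreation h ξ) = 0 := by
  rw [← inner_conj_symm, inner_vacuum_right, leftCreation_apply_zero]
  simp

theorem adjoint_leftCreation_vacuum (h : HC) : adjoint (leftCreation h) vacuum = 0 :=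
  ext_inner_left ℂ fun η => by
    rw [ContinuousLinearMap.adjoint_inner_right, inner_vacuum_right, leftCreation_apply_zero]
    simp

theorem adjoint_rightCreation_vacuum (h : HC) : adjoint (rightCreation h) vacuum = 0 :=
  ext_inner_left ℂ fun η => by
    rw [ContinuousLinearMap.adjoint_inner_right, inner_vacuum_right, rightCreation_apply_zero]
    simp

theorem leftCreation_rightCreation (h k : HC) (ξ : Fock) :
    leftCreation h (rightCreation k ξ) = rightCreation k (leftCreation h ξ) := by
  ext1; funext n
  match n with
  | 0 => rfl
  | 1 => exact (tensor_zero h).trans (tensorRight_zero k).symm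
  | n + 2 => exact tensor_tensorRight h (ξ n) k

theorem leftCreation_vacuum (h : HC) : leftCreation h vacuum = rightCreation h vacuum := by
  ext1; funext n
  match n with
  | 0 => rfl
  | 1 =>
    rw [leftCreation_apply_succ, rightCreation_apply_succ, vacuum_eq_single, lp.single_apply_self,
      tensor_unitChaos]
  | n + 2 =>
    rw [leftCreation_apply_succ, rightCreation_apply_succ, vacuum_eq_single,
      lp.single_apply_ne _ _ _ (Nat.succ_ne_zero n), tensor_zero, tensorRight_zero]

theorem leftCreation_single (h : HC) (n : ℕ) (f : Chaos n) :
    leftCreation h (lp.single 2 n f) = lp.single 2 (n + 1) (tensor h f) := by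
  ext1; funext m
  match m with
  | 0 => rw [leftCreation_apply_zero, lp.single_apply_ne _ _ _ (Nat.succ_ne_zero n).symm]
  | m + 1 =>
    rw [leftCreation_apply_succ]
    by_cases hm : m = n
    · subst hm
      rw [lp.single_apply_self, lp.single_apply_self]
    · rw [lp.single_apply_ne _ _ _ hm, lp.single_apply_ne _ _ _ (by omega), tensor_zero]

theorem exists_smul_unitChaos (f : Chaos 0) : ∃ c : ℂ, f = c • unitChaos := by
  refine ⟨f 0, Lp.ext ?_⟩
  filter_upwards [Lp.coeFn_smul (f 0) unitChaos, coeFn_unitChaos] with t h1 h2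
  rw [h1, Pi.smul_apply, h2, Subsingleton.elim t 0]
  simp

/-- A closed subspace containing the vacuum and invariant under the left creation operators by
real functions is the whole Fock space. -/
theorem eq_top_of_leftCreation_mem (M : Submodule ℂ Fock) (hM : IsClosed (M : Set Fock))
    (h0 : vacuum ∈ M) (hl : ∀ (h : HR), ∀ ξ ∈ M, leftCreation (complexify h) ξ ∈ M) : M = ⊤ := by
  have key : ∀ (n : ℕ) (f : Chaos n), lp.single 2 n f ∈ M := by
    intro n
    induction n with
    | zero =>
      intro f
      obtain ⟨c, rfl⟩ := exists_smul_unitChaos f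
      rw [lp.single_smul]
      exact M.smul_mem c h0
    | succ n ih =>
      let T : Chaos (n + 1) →L[ℂ] Fock := lp.singleContinuousLinearMap ℂ Chaos 2 (n + 1)
      -- Vectors of degree `n + 1` are limits of combinations of `l(h)f` with `h` real and `f` of
      -- degree `n`.
      have hle : (Submodule.span ℂ (realTensors n)).topologicalClosure ≤
          M.comap T.toLinearMap := by
        refine Submodule.topologicalClosure_minimal _ (Submodule.span_le.2 ?_)
          (hM.preimage T.continuous)
        rintro _ ⟨h, f, rfl⟩
        change lp.single 2 (n + 1) (tensor (complexify h) f) ∈ M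
        rw [← leftCreation_single]
        exact hl h _ (ih f)
      rw [topologicalClosure_span_realTensors] at hle
      exact fun f => hle (Submodule.mem_top (x := f))
  rw [eq_top_iff]
  intro ξ _
  exact hM.mem_of_tendsto (lp.hasSum_single (by norm_num) ξ)
    (Eventually.of_forall fun s => M.sum_mem fun i _ => key i _)

/-! ### Commutation of left and right operators -/

/-- The orthogonal projection onto the line spanned by the vacuum. -/
def vacuumProj : Op := (innerSL ℂ vacuum).smulRight vacuum

theorem vacuumProj_apply (ξ : Fock) : vacuumProj ξ = inner ℂ vacuum ξ • vacuum := rfl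

theorem adjoint_vacuumProj : adjoint vacuumProj = vacuumProj := by
  symm
  rw [ContinuousLinearMap.eq_adjoint_iff]
  intro x y
  rw [vacuumProj_apply, vacuumProj_apply, inner_smul_left, inner_smul_right, inner_conj_symm,
    mul_comm]

/-- Removing the first letter and appending a last one commute unless the word is empty: then the
appended letter is also the first one, which produces the vacuum term. It suffices to check `Ω` and
the vectors `l(a)ξ`. -/
theorem adjoint_leftCreation_mul_rightCreation (h k : HC) :
    adjoint (leftCreation h) * rightCreation k =
      rightCreation k * adjoint (leftCreation h) + inner ℂ h k • vacuumProj := by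
  suffices hM : LinearMap.eqLocus (adjoint (leftCreation h) * rightCreation k).toLinearMap
      (rightCreation k * adjoint (leftCreation h) + inner ℂ h k • vacuumProj).toLinearMap = ⊤ by
    ext1 ξ
    exact (hM ▸ Submodule.mem_top : ξ ∈ LinearMap.eqLocus _ _)
  refine eq_top_of_leftCreation_mem _ (isClosed_eq (ContinuousLinearMap.continuous _)
    (ContinuousLinearMap.continuous _)) ?_ ?_
  · change adjoint (leftCreation h) (rightCreation k vacuum) =
      rightCreation k (adjoint (leftCreation h) vacuum) + inner ℂ h k • vacuumProj vacuum
    rw [← leftCreation_vacuum, adjoint_leftCreation_leftCreation, adjoint_leftCreation_vacuum,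
      vacuumProj_apply, inner_vacuum_vacuum]
    simp
  · intro a ξ _
    change adjoint (leftCreation h) (rightCreation k (leftCreation (complexify a) ξ)) =
      rightCreation k (adjoint (leftCreation h) (leftCreation (complexify a) ξ)) +
        inner ℂ h k • vacuumProj (leftCreation (complexify a) ξ)
    rw [← leftCreation_rightCreation, adjoint_leftCreation_leftCreation,
      adjoint_leftCreation_leftCreation, vacuumProj_apply, inner_vacuum_leftCreation]
    simp

theorem adjoint_leftCreation_rightCreation (h k : HC) (ξ : Fock) :
    adjoint (leftCreation h) (rightCreation k ξ) =
      rightCreation k (adjoint (leftCreation h) ξ) + inner ℂ h k • vacuumProj ξ :=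
  DFunLike.congr_fun (adjoint_leftCreation_mul_rightCreation h k) ξ

theorem adjoint_rightCreation_mul_leftCreation (h k : HC) :
    adjoint (rightCreation k) * leftCreation h =
      leftCreation h * adjoint (rightCreation k) + inner ℂ k h • vacuumProj := by
  have := congrArg star (adjoint_leftCreation_mul_rightCreation h k)
  simp only [star_add, star_mul, star_smul, ContinuousLinearMap.star_eq_adjoint,
    ContinuousLinearMap.adjoint_adjoint, adjoint_vacuumProj] at this
  rw [this, ← inner_conj_symm k h]
  rfl

/-- The right semicircular operator `r(h) + r(h)*`, for real `h`. -/
def rightS (h : HR) : Op :=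
  rightCreation (complexify h) + adjoint (rightCreation (complexify h))

/-- The commutators `[l(h)*, r(k)]` and `[l(h), r(k)*]` are `⟨h, k⟩P` and `-⟨k, h⟩P`; they cancel
because `h` and `k` are real. -/
theorem S_mul_rightS (h k : HR) : S h * rightS k = rightS k * S h := by
  have h1 : leftCreation (complexify h) * rightCreation (complexify k) =
      rightCreation (complexify k) * leftCreation (complexify h) :=
    ContinuousLinearMap.ext fun ξ => leftCreation_rightCreation _ _ ξ
  have h2 := congrArg star h1
  simp only [star_mul, ContinuousLinearMap.star_eq_adjoint] at h2
  have h3 := adjoint_leftCreation_mul_rightCreation (complexify h) (complexify k)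
  have h4 := adjoint_rightCreation_mul_leftCreation (complexify h) (complexify k)
  rw [inner_complexify] at h3 h4
  rw [real_inner_comm] at h4
  rw [S, rightS, add_mul, mul_add, mul_add, add_mul, mul_add, mul_add, h1, h2, h3, h4]
  abel

/-! ### Annihilation along an orthonormal sequence -/

theorem isClosed_setOf_tendsto_zero {E : Type*} [NormedAddCommGroup E] [NormedSpace ℂ E]
    (A : ℕ → E →L[ℂ] E) (hA : ∀ k, ‖A k‖ ≤ 1) :
    IsClosed {x | Tendsto (fun k => A k x) atTop (𝓝 0)} := by
  rw [← isSeqClosed_iff_isClosed]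
  intro u x hu hx
  change Tendsto (fun k => A k x) atTop (𝓝 0)
  rw [Metric.tendsto_atTop] at hx ⊢
  intro ε hε
  obtain ⟨m, hm⟩ := hx (ε / 2) (half_pos hε)
  obtain ⟨N, hN⟩ := Metric.tendsto_atTop.1 (hu m) (ε / 2) (half_pos hε)
  refine ⟨N, fun k hk => ?_⟩
  have h1 := hN k hk
  have h2 := hm m le_rfl
  rw [dist_zero_right] at h1 ⊢
  rw [dist_comm, dist_eq_norm] at h2
  have h3 : ‖A k (x - u m)‖ ≤ ‖x - u m‖ :=
    ((A k).le_of_opNorm_le (hA k) _).trans_eq (one_mul _)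
  have h4 : A k x = A k (x - u m) + A k (u m) := by rw [← map_add, sub_add_cancel]
  rw [h4]
  linarith [norm_add_le (A k (x - u m)) (A k (u m))]

/-- The vectors at which a sequence of operators tends to zero. -/
def nullSubmodule (A : ℕ → Op) : Submodule ℂ Fock where
  carrier := {x | Tendsto (fun k => A k x) atTop (𝓝 0)}
  zero_mem' := by simp
  add_mem' := fun {x y} hx hy => by simpa using Tendsto.add hx hy
  smul_mem' := fun c x hx => by simpa using Tendsto.const_smul hx c

theorem mem_nullSubmodule {A : ℕ → Op} {x : Fock} :
    x ∈ nullSubmodule A ↔ Tendsto (fun k => A k x) atTop (𝓝 0) := Iff.rfl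

theorem norm_complexify (h : HR) : ‖complexify h‖ = ‖h‖ := by
  have h1 := inner_complexify h h
  rw [inner_self_eq_norm_sq_to_K, real_inner_self_eq_norm_sq] at h1
  have h2 : ‖complexify h‖ ^ 2 = ‖h‖ ^ 2 := Complex.ofReal_injective (by simpa using h1)
  exact (sq_eq_sq₀ (norm_nonneg _) (norm_nonneg _)).1 h2

/-- By Bessel's inequality the squared coefficients are summable. -/
theorem tendsto_inner_complexify {e : ℕ → HR} (he : Orthonormal ℝ e) (h : HR) :
    Tendsto (fun k => inner ℂ (complexify (e k)) (complexify h)) atTop (𝓝 0) := by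
  have h1 := (he.inner_products_summable h).tendsto_atTop_zero
  rw [tendsto_zero_iff_norm_tendsto_zero]
  have h2 := h1.sqrt
  simpa [inner_complexify, Real.sqrt_sq_eq_abs] using h2

theorem tendsto_adjoint_leftCreation {e : ℕ → HR} (he : Orthonormal ℝ e) (x : Fock) :
    Tendsto (fun k => adjoint (leftCreation (complexify (e k))) x) atTop (𝓝 0) := by
  suffices hM : nullSubmodule (fun k => adjoint (leftCreation (complexify (e k)))) = ⊤ from
    mem_nullSubmodule.1 (hM ▸ Submodule.mem_top)
  refine eq_top_of_leftCreation_mem _ (isClosed_setOf_tendsto_zero _ fun k => ?_) ?_ ?_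
  · rw [LinearIsometryEquiv.norm_map]
    exact (norm_leftCreation_le _).trans_eq (by rw [norm_complexify, he.1 k])
  · simp [mem_nullSubmodule, adjoint_leftCreation_vacuum]
  · intro a ξ _
    simp only [mem_nullSubmodule, adjoint_leftCreation_leftCreation]
    simpa using (tendsto_inner_complexify he a).smul_const ξ

/-- Convergence passes from `ξ` to `l(a)ξ` because `r(e)*` commutes with `l(a)` up to `⟨e, a⟩P`,
whose coefficient tends to zero. -/
theorem tendsto_adjoint_rightCreation {e : ℕ → HR} (he : Orthonormal ℝ e) (x : Fock) :
    Tendsto (fun k => adjoint (rightCreation (complexify (e k))) x) atTop (𝓝 0) := by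
  suffices hM : nullSubmodule (fun k => adjoint (rightCreation (complexify (e k)))) = ⊤ from
    mem_nullSubmodule.1 (hM ▸ Submodule.mem_top)
  refine eq_top_of_leftCreation_mem _ (isClosed_setOf_tendsto_zero _ fun k => ?_) ?_ ?_
  · rw [LinearIsometryEquiv.norm_map]
    exact (norm_rightCreation_le _).trans_eq (by rw [norm_complexify, he.1 k])
  · simp [mem_nullSubmodule, adjoint_rightCreation_vacuum]
  · intro a ξ hξ
    rw [mem_nullSubmodule] at hξ ⊢
    have h1 : ∀ k, adjoint (rightCreation (complexify (e k))) (leftCreation (complexify a) ξ) =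
        leftCreation (complexify a) (adjoint (rightCreation (complexify (e k))) ξ) +
          inner ℂ (complexify (e k)) (complexify a) • vacuumProj ξ := fun k =>
      DFunLike.congr_fun (adjoint_rightCreation_mul_leftCreation (complexify a)
        (complexify (e k))) ξ
    simp only [h1]
    simpa using (((leftCreation (complexify a)).continuous.tendsto 0).comp
      (by simpa using hξ)).add ((tendsto_inner_complexify he a).smul_const (vacuumProj ξ))

/-! ### Vectors on which left and right semicircular operators agree -/

/-- Used with `A = l(e)`, `B = l(e)*`, `C = r(e)`, `D = r(e)*` and `P` the vacuum projection. -/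
theorem sub_eq_of_apply_add_apply {E : Type*} [AddCommGroup E] [Module ℂ E]
    [TopologicalSpace E] {A B C D P : E →L[ℂ] E} {x : E} (h : A x + B x = C x + D x)
    (hBA : B (A x) = x) (hBC : B (C x) = C (B x) + P x) :
    x - P x = C (B x) + B (D x) - B (B x) := by
  have h1 := congrArg B h
  rw [map_add, map_add, hBA, hBC] at h1
  rw [sub_eq_iff_eq_add, sub_add_eq_add_sub, eq_sub_iff_add_eq, h1]
  abel

/-- A vector on which left and right semicircular operators agree is a multiple of the vacuum. -/
theorem eq_vacuumProj_of_S_eq_rightS {ξ : Fock} (hξ : ∀ h, S h ξ = rightS h ξ) :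
    ξ = vacuumProj ξ := by
  obtain ⟨e, he⟩ := exists_orthonormal_HR
  have hl := tendsto_adjoint_leftCreation he ξ
  have hr := tendsto_adjoint_rightCreation he ξ
  have hc : ∀ k, ‖complexify (e k)‖ = 1 := fun k => by rw [norm_complexify, he.1 k]
  have hnl : ∀ k x, ‖adjoint (leftCreation (complexify (e k))) x‖ ≤ ‖x‖ := fun k x =>
    (ContinuousLinearMap.le_of_opNorm_le _ (by
      rw [LinearIsometryEquiv.norm_map]
      exact (norm_leftCreation_le _).trans_eq (hc k)) x).trans_eq (one_mul _)
  have hnr : ∀ k x, ‖rightCreation (complexify (e k)) x‖ ≤ ‖x‖ := fun k x =>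
    (ContinuousLinearMap.le_of_opNorm_le _ ((norm_rightCreation_le _).trans_eq (hc k))
      x).trans_eq (one_mul _)
  have hid : ∀ k, ξ - vacuumProj ξ =
      rightCreation (complexify (e k)) (adjoint (leftCreation (complexify (e k))) ξ) +
      adjoint (leftCreation (complexify (e k))) (adjoint (rightCreation (complexify (e k))) ξ) -
      adjoint (leftCreation (complexify (e k))) (adjoint (leftCreation (complexify (e k))) ξ) := by
    intro k
    have hcc : inner ℂ (complexify (e k)) (complexify (e k)) = (1 : ℂ) := by
      rw [inner_self_eq_norm_sq_to_K, hc k]; simp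
    refine sub_eq_of_apply_add_apply (hξ (e k)) ?_ ?_
    · rw [adjoint_leftCreation_leftCreation, hcc, one_smul]
    · rw [adjoint_leftCreation_rightCreation, hcc, one_smul]
  -- The outer factors are contractions, so each term is bounded by its inner annihilation applied
  -- to `ξ`.
  have hbound : ∀ k, ‖ξ - vacuumProj ξ‖ ≤
      ‖adjoint (leftCreation (complexify (e k))) ξ‖ +
      ‖adjoint (rightCreation (complexify (e k))) ξ‖ +
      ‖adjoint (leftCreation (complexify (e k))) ξ‖ := by
    intro k
    rw [hid k]
    exact (norm_sub_le _ _).trans (add_le_add ((norm_add_le _ _).trans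
      (add_le_add (hnr k _) (hnl k _))) (hnl k _))
  have hlim : ‖ξ - vacuumProj ξ‖ ≤ 0 :=
    ge_of_tendsto' (by simpa using (hl.norm.add hr.norm).add hl.norm) hbound
  exact sub_eq_zero.1 (norm_le_zero_iff.1 hlim)

/-! ### Triviality of the centre -/

theorem S_mem_SC (h : HR) : S h ∈ SC := by
  rw [← SetLike.mem_coe, coe_SC]
  exact Set.subset_centralizer_centralizer ⟨h, rfl⟩

theorem rightS_mul_of_mem_SC {F : Op} (hF : F ∈ SC) (h : HR) : rightS h * F = F * rightS h := by
  rw [← SetLike.mem_coe, coe_SC] at hF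
  refine hF (rightS h) ?_
  rintro _ ⟨k, rfl⟩
  exact S_mul_rightS k h

/-- An operator that commutes with all `S(h)` and has the vacuum as an eigenvector is a scalar. -/
theorem eq_smul_one_of_commute {F : Op} (hF : ∀ h, F * S h = S h * F) {c : ℂ}
    (hc : F vacuum = c • vacuum) : F = c • (1 : Op) := by
  let K : Submodule ℂ Fock := LinearMap.eqLocus F.toLinearMap (c • (1 : Op)).toLinearMap
  have hmem : ∀ x, x ∈ K ↔ F x = c • x := fun x => Iff.rfl
  have hK : IsClosed (K : Set Fock) := isClosed_eq F.continuous (c • (1 : Op)).continuous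
  have hS : ∀ h, ∀ x ∈ K, S h x ∈ K := by
    intro h x hx
    rw [hmem] at hx ⊢
    have h1 : F (S h x) = S h (F x) := DFunLike.congr_fun (hF h) x
    rw [h1, hx, map_smul]
  -- `K` is visibly invariant under `S b` but not under `l(b) = S b - l(b)*`. Also requiring `l(a)*x
  -- ∈ K` for all `a` repairs this, and the requirement survives `l(b)` because `l(a)*l(b)` is a
  -- scalar.
  let M : Submodule ℂ Fock := K ⊓ ⨅ a : HR,
    K.comap (adjoint (leftCreation (complexify a))).toLinearMap
  have hM : ∀ x, x ∈ M ↔ x ∈ K ∧ ∀ a : HR, adjoint (leftCreation (complexify a)) x ∈ K := by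
    intro x
    simp [M, Submodule.mem_inf, Submodule.mem_iInf]
  have hMtop : M = ⊤ := by
    refine eq_top_of_leftCreation_mem M ?_ ?_ ?_
    · have hset : (M : Set Fock) = (K : Set Fock) ∩
          ⋂ a : HR, adjoint (leftCreation (complexify a)) ⁻¹' (K : Set Fock) := by
        ext x
        simp only [SetLike.mem_coe, hM, Set.mem_inter_iff, Set.mem_iInter, Set.mem_preimage]
      rw [hset]
      exact hK.inter (isClosed_iInter fun a => hK.preimage (ContinuousLinearMap.continuous _))
    · rw [hM]
      refine ⟨hc, fun a => ?_⟩
      rw [adjoint_leftCreation_vacuum]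
      exact K.zero_mem
    · intro b x hx
      rw [hM] at hx ⊢
      refine ⟨?_, fun a => ?_⟩
      · have h1 : leftCreation (complexify b) x =
            S b x - adjoint (leftCreation (complexify b)) x := by
          rw [S, add_apply, add_sub_cancel_right]
        rw [h1]
        exact K.sub_mem (hS b x hx.1) (hx.2 b)
      · rw [adjoint_leftCreation_leftCreation]
        exact K.smul_mem _ hx.1
  ext1 x
  exact ((hM x).1 (hMtop ▸ Submodule.mem_top)).1

theorem exists_eq_smul_one_of_mem_center {F : Op} (hF : F ∈ SC) (hc : ∀ G ∈ SC, F * G = G * F) :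
    ∃ c : ℂ, F = c • (1 : Op) := by
  have hcS : ∀ h, F * S h = S h * F := fun h => hc _ (S_mem_SC h)
  have hvac : ∀ h, S h vacuum = rightS h vacuum := by
    intro h
    rw [S, rightS, add_apply, add_apply,
      adjoint_leftCreation_vacuum, adjoint_rightCreation_vacuum, leftCreation_vacuum]
  have hξ := eq_vacuumProj_of_S_eq_rightS (ξ := F vacuum) fun h => by
    have h1 : F (S h vacuum) = S h (F vacuum) := DFunLike.congr_fun (hcS h) vacuum
    have h2 : rightS h (F vacuum) = F (rightS h vacuum) :=
      DFunLike.congr_fun (rightS_mul_of_mem_SC hF h) vacuum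
    rw [← h1, h2, hvac]
  exact ⟨_, eq_smul_one_of_commute hcS hξ⟩

/-- Constants already lie in the initial domain, with zero gradient, so no limit is needed. -/
theorem toL2_smul_one_mem_D12 (c : ℂ) : toL2 (c • (1 : Op)) ∈ D12 := by
  refine ⟨(toL2 (c • (1 : Op)), toBiprocess (c • (0 : AlgBiprocess))), ?_, rfl⟩
  exact Submodule.le_topologicalClosure _ ⟨_, _, IsGradient.one.smul c, rfl⟩

end Wigner

end

theorem mainTheorem3 (F : Wigner.Fock →L[ℂ] Wigner.Fock) :
    (F ∈ Wigner.SC ∧ Wigner.toL2 F ∈ Wigner.D12 ∧ ∀ G ∈ Wigner.SC, F * G = G * F) ↔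
      ∃ c : ℂ, F = c • (1 : Wigner.Fock →L[ℂ] Wigner.Fock) := by
  constructor
  · rintro ⟨hF, -, hc⟩
    exact Wigner.exists_eq_smul_one_of_mem_center hF hc
  · rintro ⟨c, rfl⟩
    refine ⟨?_, Wigner.toL2_smul_one_mem_D12 c, fun G _ => by simp⟩
    rw [← SetLike.mem_coe, Wigner.coe_SC]
    intro G _
    simp
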